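/- All graphs are finite, simple, undirected and connected. A \emph{block} of a graph is a maximal connected subgraph having no cut vertex of its own, and a \emph{block graph} is a connected graph all of whose blocks are cliques. The detour distance $D(u,v)$ is the length of a longest path between $u$ and $v$; the detour eccentricity of a vertex $v$ is $\max_u D(v,u)$; the detour center $C_D(G)$ is the set of vertices of minimum detour eccentricity, and $\omega=|C_D(G)|$. The detour level of a vertex $u$ is $\mathcal L(u)=\min\{D(w,u): w\in C_D(G)\}$, and $\mathcal L(G)=\sum_{u\in V(G)}\mathcal L(u)$. If $\omega=1$, let $\xi=\min(|V(B)|-1)$ over the blocks $B$ containing the detour central vertex; otherwise let $\xi=0$. A hamiltonian coloring of a graph $G$ of order $n$ is a map $c:V(G)\to\{0,1,2,\dots\}$ with $D(u,v)+|c(u)-c(v)|\ge n-1$ for all distinct $u,v$; $hc(G)$ is the minimum over all hamiltonian colorings of the maximum color used, and a hamiltonian coloring attaining this minimum is called optimal. \textbf{Theorem.} Let $G$ be a block graph of order $n$. Then $$hc(G)=(n-1)(n-\omega)-2\mathcal L(G)+\xi$$ if and only if there is an ordering $u_0,u_1,\dots,u_{n-1}$ of the vertices of $G$ such that $\mathcal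 L(u_0)=0$, $\mathcal L(u_{n-1})=\xi$ if $\omega=1$, $\mathcal L(u_{n-1})=0$ if $\omega\ge 2$, and $$D(u_i,u_j)\ \ge\ \sum_{t=i}^{j-1}\bigl(\mathcal L(u_t)+\mathcal L(u_{t+1})\bigr)-(j-i)(n-\omega)+(n-1)\qquad\text{for all }0\le i<j\le n-1.$$ Moreover, for every ordering satisfying these conditions, the mapping $c$ defined by $c(u_0)=0$ and $c(u_{i+1})=c(u_i)+n-\omega-\mathcal L(u_{i+1})-\mathcal L(u_i)$ for $0\le i\le n-2$ takes non-negative integer values and is an optimal hamiltonian coloring of $G$. -/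

import Mathlib

namespace SimpleGraph

/-- The detour distance `D(u, v)`: the length of a longest path between `u` and `v`.
It is used for finite connected graphs only, where the set is non-empty and bounded. -/
noncomputable def detourDist {V : Type*} (G : SimpleGraph V) (u v : V) : ℕ :=
  sSup {k : ℕ | ∃ p : G.Walk u v, p.IsPath ∧ p.length = k}

/-- The detour eccentricity of `v`: the largest detour distance from `v` to a vertex. -/
noncomputable def detourEcc {V : Type*} [Fintype V] (G : SimpleGraph V) (v : V) : ℕ :=
  Finset.univ.sup fun u => G.detourDist v u

/-- The vertex set of the detour center `C_D(G)`: the vertices of minimum detour eccentricity. -/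
def detourCenter {V : Type*} [Fintype V] (G : SimpleGraph V) : Set V :=
  {v | ∀ u, G.detourEcc v ≤ G.detourEcc u}

/-- `ω = |C_D(G)|`, the number of detour central vertices. -/
noncomputable def detourOmega {V : Type*} [Fintype V] (G : SimpleGraph V) : ℕ :=
  G.detourCenter.ncard

/-- The detour level `𝓛(u)`: the least detour distance from a detour central vertex to `u`. -/
noncomputable def detourLevel {V : Type*} [Fintype V] (G : SimpleGraph V) (u : V) : ℕ :=
  sInf ((fun w => G.detourDist w u) '' G.detourCenter)

/-- The total detour level `𝓛(G)`. -/
noncomputable def totalDetourLevel {V : Type*} [Fintype V] (G : SimpleGraph V) : ℕ :=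
  ∑ u, G.detourLevel u

/-- A cut vertex of a finite graph: a vertex whose deletion increases the number of
connected components. -/
def IsCutVertex {V : Type*} (G : SimpleGraph V) (v : V) : Prop :=
  Nat.card G.ConnectedComponent < Nat.card (G.induce ({v}ᶜ : Set V)).ConnectedComponent

/-- A block of `G`: a maximal connected subgraph of `G` that has no cut vertex (of its own). -/
def IsBlock {V : Type*} (G : SimpleGraph V) (B : G.Subgraph) : Prop :=
  Maximal (fun H : G.Subgraph => H.Connected ∧ ∀ v, ¬ H.coe.IsCutVertex v) B

/-- A block graph: a connected graph all of whose blocks are cliques. -/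
def IsBlockGraph {V : Type*} (G : SimpleGraph V) : Prop :=
  G.Connected ∧ ∀ B : G.Subgraph, G.IsBlock B → G.IsClique B.verts

/-- `ξ`: if there is exactly one detour central vertex, the minimum of `|V(B)| - 1` over the
blocks `B` containing it; otherwise `0`. -/
noncomputable def detourXi {V : Type*} [Fintype V] (G : SimpleGraph V) : ℕ :=
  if G.detourOmega = 1 then
    sInf {k : ℕ | ∃ B : G.Subgraph, G.IsBlock B ∧ (∃ w ∈ G.detourCenter, w ∈ B.verts) ∧
      k = B.verts.ncard - 1}
  else 0

/-- A hamiltonian coloring: colors are non-negative integers and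
`D(u, v) + |c(u) - c(v)| ≥ n - 1` for all distinct `u`, `v`, where `n` is the order. -/
def IsHamiltonianColoring {V : Type*} [Fintype V] (G : SimpleGraph V) (c : V → ℕ) : Prop :=
  ∀ u v : V, u ≠ v → (Fintype.card V : ℤ) - 1 ≤ G.detourDist u v + |(c u : ℤ) - (c v : ℤ)|

/-- The hamiltonian chromatic number `hc(G)`: the minimum, over all hamiltonian colorings,
of the maximum color used. -/
noncomputable def hamChromaticNumber {V : Type*} [Fintype V] (G : SimpleGraph V) : ℕ :=
  sInf {k : ℕ | ∃ c : V → ℕ, G.IsHamiltonianColoring c ∧ k = Finset.univ.sup c}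

/-- A hamiltonian coloring whose maximum color equals `hc(G)`. -/
def IsOptimalHamiltonianColoring {V : Type*} [Fintype V] (G : SimpleGraph V) (c : V → ℕ) : Prop :=
  G.IsHamiltonianColoring c ∧ Finset.univ.sup c = G.hamChromaticNumber

/-- The sequence `u 0, u 1, …, u (n - 1)` is an ordering of the vertices, where `n` is the order
(the values `u i` with `i ≥ n` play no role). -/
def IsVertexOrdering {V : Type*} [Fintype V] (u : ℕ → V) : Prop :=
  Set.BijOn u (Set.Iio (Fintype.card V)) Set.univ

/-- The conditions on a vertex ordering `u 0, …, u (n - 1)`: the prescribed detour levels of the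
two end vertices, and the lower bound on `D(u i, u j)` for all `i < j`. -/
def IsTightOrdering {V : Type*} [Fintype V] (G : SimpleGraph V) (u : ℕ → V) : Prop :=
  IsVertexOrdering u ∧
  G.detourLevel (u 0) = 0 ∧
  (G.detourOmega = 1 → G.detourLevel (u (Fintype.card V - 1)) = G.detourXi) ∧
  (2 ≤ G.detourOmega → G.detourLevel (u (Fintype.card V - 1)) = 0) ∧
  ∀ i j : ℕ, i < j → j < Fintype.card V →
    ∑ t ∈ Finset.Ico i j, ((G.detourLevel (u t) : ℤ) + (G.detourLevel (u (t + 1)) : ℤ))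
        - ((j : ℤ) - (i : ℤ)) * ((Fintype.card V : ℤ) - (G.detourOmega : ℤ))
        + ((Fintype.card V : ℤ) - 1)
      ≤ (G.detourDist (u i) (u j) : ℤ)

/-- `c` is given along the ordering `u` by `c(u 0) = 0` and
`c(u (i+1)) = c(u i) + n - ω - 𝓛(u (i+1)) - 𝓛(u i)` for `0 ≤ i ≤ n - 2`. -/
def IsColoringAlong {V : Type*} [Fintype V] (G : SimpleGraph V) (u : ℕ → V) (c : V → ℕ) : Prop :=
  c (u 0) = 0 ∧
  ∀ i : ℕ, i + 1 < Fintype.card V →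
    (c (u (i + 1)) : ℤ) = (c (u i) : ℤ) + (Fintype.card V : ℤ) - (G.detourOmega : ℤ)
      - (G.detourLevel (u (i + 1)) : ℤ) - (G.detourLevel (u i) : ℤ)

end SimpleGraph

/-! The engine is the inequality `D(u,v) ≤ 𝓛(u) + 𝓛(v) + ω - 1`
(`IsBlockGraph.detourDist_lt_detourLevel_add`). It follows from the triangle inequality for `D` and
from the fact that a path between two central vertices stays in the detour center. The latter holds
because `D(·, y)` is quasi-convex along paths of a block graph (`IsBlockGraph.detourDist_le_max`),
which is where cliques enter: a path may cross a clique block along a Hamiltonian path of it.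

Sort the vertices by a hamiltonian coloring. Consecutive colors differ by at least `n - ω - 𝓛(u i) -
𝓛(u (i+1))`, and summing bounds the largest color below by `(n-1)(n-ω) - 2𝓛(G) + 𝓛(u 0) + 𝓛(u
(n-1))`. The two end levels add up to at least `ξ`.

Attaining the bound forces equality at every step and at the ends. All color differences are then
explicit, and the coloring condition for `u i`, `u j` becomes exactly the required lower bound on
`D(u i, u j)`. Conversely, that bound makes the recursively defined map a hamiltonian coloring, and
its largest color telescopes to the lower bound. -/

namespace SimpleGraph

variable {V : Type*} {G : SimpleGraph V}

/-! ### Cutting and joining paths. -/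

namespace Walk

theorem IsPath.eq_nil_of_closed {u : V} {p : G.Walk u u} (hp : p.IsPath) : p = Walk.nil :=
  (isPath_iff_nil.1 hp).eq_nil

theorem IsPath.append_of_inter {u v w : V} {p : G.Walk u v} {q : G.Walk v w} (hp : p.IsPath)
    (hq : q.IsPath) (h : ∀ x ∈ p.support, x ∈ q.support → x = v) : (p.append q).IsPath := by
  induction p with
  | nil => simpa using hq
  | cons hadj p ih =>
    rw [cons_append, cons_isPath_iff, mem_support_append_iff]
    rw [cons_isPath_iff] at hp
    refine ⟨ih hp.1 hq fun x hx => h x (by simp [hx]), ?_⟩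
    rintro (h1 | h1)
    · exact hp.2 h1
    · have := h _ (by simp) h1
      subst this
      exact hp.2 p.end_mem_support

/-- Cutting a walk that ends in `S` at the first vertex of `S`. -/
theorem exists_append_first {u v : V} (p : G.Walk u v) {S : Set V} (hv : v ∈ S) :
    ∃ z ∈ S, ∃ (q : G.Walk u z) (r : G.Walk z v), p = q.append r ∧
      ∀ x ∈ q.support, x ∈ S → x = z := by
  induction p with
  | nil => exact ⟨_, hv, nil, nil, rfl, by simp⟩
  | @cons u _ _ hadj p ih =>
    by_cases hu : u ∈ S
    · exact ⟨u, hu, nil, cons hadj p, rfl, by simp⟩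
    · obtain ⟨z, hz, q, r, rfl, h⟩ := ih hv
      refine ⟨z, hz, cons hadj q, r, rfl, fun x hx hxS => ?_⟩
      rw [support_cons, List.mem_cons] at hx
      rcases hx with rfl | hx
      · exact absurd hxS hu
      · exact h x hx hxS

/-- Cutting a walk that starts in `S` at the last vertex of `S`. -/
theorem exists_append_last {u v : V} (p : G.Walk u v) {S : Set V} (hu : u ∈ S) :
    ∃ z ∈ S, ∃ (q : G.Walk u z) (r : G.Walk z v), p = q.append r ∧
      ∀ x ∈ r.support, x ∈ S → x = z := by
  obtain ⟨z, hz, q, r, h, hq⟩ := p.reverse.exists_append_first hu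
  refine ⟨z, hz, r.reverse, q.reverse, ?_, by simpa using hq⟩
  rw [← reverse_append, ← h, reverse_reverse]

/-- Two paths with a common vertex: the start of the second is joined to the end of the first
by a path through a common vertex. -/
theorem IsPath.exists_isPath_through_common {w a b y s : V} {p : G.Walk w a} {q : G.Walk b y}
    (hp : p.IsPath) (hq : q.IsPath) (hsp : s ∈ p.support) (hsq : s ∈ q.support) :
    ∃ t ∈ p.support, t ∈ q.support ∧ ∃ r : G.Walk b a, r.IsPath ∧ t ∈ r.support := by
  obtain ⟨q₁, q₂, rfl⟩ := Walk.mem_support_iff_exists_append.1 hsq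
  obtain ⟨t, ht, q₃, q₄, rfl, h⟩ := q₁.exists_append_first (S := {x | x ∈ p.support}) hsp
  obtain ⟨p₁, p₂, rfl⟩ := Walk.mem_support_iff_exists_append.1 ht
  refine ⟨t, ht, by simp [mem_support_append_iff], q₃.append p₂, ?_,
    by simp [mem_support_append_iff]⟩
  refine hq.of_append_left.of_append_left.append_of_inter hp.of_append_right fun x hx hx' => ?_
  exact h x hx (by simp [mem_support_append_iff, hx'])

theorem IsPath.eq_of_append_of_mem {u v w x : V} {p : G.Walk u v} {q : G.Walk v w}
    (h : (p.append q).IsPath) (hp : x ∈ p.support) (hq : x ∈ q.support) : x = v := by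
  by_contra hx
  exact h.ne_of_mem_support_of_append hx hp hq rfl

theorem IsPath.length_lt_card_of_support_subset {u v : V} {p : G.Walk u v} (hp : p.IsPath)
    {S : Set V} (hS : S.Finite) (h : ∀ x ∈ p.support, x ∈ S) : p.length < S.ncard := by
  classical
  have h1 : p.support.toFinset.card = p.length + 1 := by
    rw [List.toFinset_card_of_nodup hp.support_nodup, length_support]
  have h2 : (p.support.toFinset : Set V).ncard ≤ S.ncard :=
    Set.ncard_le_ncard (fun x hx => h x (by simpa using hx)) hS
  rw [Set.ncard_coe_finset] at h2
  omega

end Walk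

theorem IsClique.exists_isPath_length_eq_card {S : Finset V} (hS : G.IsClique (S : Set V))
    {a b : V} (ha : a ∈ S) (hb : b ∈ S) (hab : a ≠ b) :
    ∃ p : G.Walk a b, p.IsPath ∧ (∀ x ∈ p.support, x ∈ S) ∧ p.length + 1 = S.card := by
  classical
  induction hn : S.card generalizing S a with
  | zero => simp_all
  | succ n ih =>
    have hcard : (S.erase a).card = n := by rw [Finset.card_erase_of_mem ha, hn]; simp
    -- Step from `a` to any vertex other than `b` while one remains, so that `b` is visited last.
    by_cases hc : ∃ c ∈ S.erase a, c ≠ b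
    · obtain ⟨c, hc, hcb⟩ := hc
      obtain ⟨p, hp, hps, hpl⟩ := ih (S := S.erase a)
        (hS.subset (by simp)) hc (by simp [hb, hab.symm]) hcb hcard
      have hca := Finset.mem_erase.1 hc
      refine ⟨Walk.cons (hS ha hca.2 hca.1.symm) p, ?_, ?_, by simp [hpl]⟩
      · rw [Walk.cons_isPath_iff]
        exact ⟨hp, fun h => by simpa using hps a h⟩
      · intro x hx
        rw [Walk.support_cons, List.mem_cons] at hx
        rcases hx with rfl | hx
        · exact ha
        · exact Finset.mem_of_mem_erase (hps x hx)
    · push Not at hc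
      have : S.erase a = {b} := by
        ext x
        simp only [Finset.mem_singleton]
        exact ⟨hc x, fun h => by simp [h, hb, hab.symm]⟩
      rw [this, Finset.card_singleton] at hcard
      refine ⟨Walk.cons (hS ha hb hab) Walk.nil, by simp [hab], ?_, by simp [← hcard]⟩
      simp [ha, hb]

theorem IsClique.exists_isPath_length_eq_ncard [Finite V] {S : Set V} (hS : G.IsClique S)
    {a b : V} (ha : a ∈ S) (hb : b ∈ S) (hab : a ≠ b) :
    ∃ p : G.Walk a b, p.IsPath ∧ (∀ x ∈ p.support, x ∈ S) ∧ p.length + 1 = S.ncard := by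
  have hf := S.toFinite
  obtain ⟨p, hp, h1, h2⟩ := IsClique.exists_isPath_length_eq_card (G := G) (S := hf.toFinset)
    (by simpa using hS) (by simpa using ha) (by simpa using hb) hab
  exact ⟨p, hp, by simpa using h1, by rw [h2, Set.ncard_eq_toFinset_card S hf]⟩

/-! ### The detour distance and its triangle inequality. -/

section Detour

theorem Walk.IsPath.length_le_detourDist [Finite V] {u v : V} {p : G.Walk u v} (hp : p.IsPath) :
    p.length ≤ G.detourDist u v := by
  refine le_csSup ⟨Nat.card V, ?_⟩ ⟨p, hp, rfl⟩
  rintro k ⟨q, hq, rfl⟩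
  have := hq.length_lt_card_of_support_subset Set.finite_univ (by simp)
  rw [Set.ncard_univ] at this
  exact this.le

theorem Connected.exists_isPath_length_eq_detourDist [Finite V] (hG : G.Connected) (u v : V) :
    ∃ p : G.Walk u v, p.IsPath ∧ p.length = G.detourDist u v := by
  refine Nat.sSup_mem (s := {k : ℕ | ∃ p : G.Walk u v, p.IsPath ∧ p.length = k}) ?_
    ⟨Nat.card V, ?_⟩
  · obtain ⟨p, hp⟩ := hG.exists_isPath u v
    exact ⟨_, p, hp, rfl⟩
  · rintro k ⟨q, hq, rfl⟩
    have := hq.length_lt_card_of_support_subset Set.finite_univ (by simp)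
    rw [Set.ncard_univ] at this
    exact this.le

theorem detourDist_comm (u v : V) : G.detourDist u v = G.detourDist v u := by
  have h : ∀ u v, {k : ℕ | ∃ p : G.Walk u v, p.IsPath ∧ p.length = k} ⊆
      {k : ℕ | ∃ p : G.Walk v u, p.IsPath ∧ p.length = k} := by
    rintro u v k ⟨p, hp, rfl⟩
    exact ⟨p.reverse, hp.reverse, by simp⟩
  rw [detourDist, (h u v).antisymm (h v u), ← detourDist]

theorem Connected.detourDist_lt_card [Fintype V] (hG : G.Connected) (u v : V) :
    G.detourDist u v < Fintype.card V := by
  obtain ⟨p, hp, h⟩ := hG.exists_isPath_length_eq_detourDist u v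
  exact h ▸ hp.length_lt

theorem Connected.detourDist_self [Finite V] (hG : G.Connected) (u : V) :
    G.detourDist u u = 0 := by
  obtain ⟨p, hp, h⟩ := hG.exists_isPath_length_eq_detourDist u u
  rw [← h, hp.eq_nil_of_closed, Walk.length_nil]

theorem Connected.detourDist_triangle [Finite V] (hG : G.Connected) (u w v : V) :
    G.detourDist u v ≤ G.detourDist u w + G.detourDist w v := by
  obtain ⟨p, hp, hl⟩ := hG.exists_isPath_length_eq_detourDist u v
  obtain ⟨q, hq⟩ := hG.exists_isPath w v
  -- Here `x` is where a path from `w` first hits a longest path from `u` to `v`. The detours `u → x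
  -- → w` and `w → x → v` are then both paths, and together they cover the longest path.
  obtain ⟨x, hx, q₁, q₂, rfl, h⟩ := q.exists_append_first (S := {x | x ∈ p.support}) (by simp)
  obtain ⟨p₁, p₂, rfl⟩ := Walk.mem_support_iff_exists_append.1 hx
  have hq₁ := hq.of_append_left
  have h1 := (hp.of_append_left.append_of_inter hq₁.reverse fun y hy hy' =>
    h y (by simpa using hy') (by simp [Walk.mem_support_append_iff, hy])).length_le_detourDist
  have h2 := (hq₁.append_of_inter hp.of_append_right fun y hy hy' =>
    h y hy (by simp [Walk.mem_support_append_iff, hy'])).length_le_detourDist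
  simp only [Walk.length_append, Walk.length_reverse] at h1 h2 hl
  omega

end Detour

/-! ### Blocks and the quasi-convexity of the detour distance. -/

section Block

/-- A set of vertices that induces a connected subgraph without cut vertices is contained in a
subgraph of the kind whose maximal members are the blocks. -/
theorem connected_and_not_isCutVertex_induce [Finite V] {S : Set V} (hS : S.Nonempty)
    (hc : ∀ a ∈ S, ∀ b ∈ S, ∃ p : G.Walk a b, ∀ x ∈ p.support, x ∈ S)
    (hs : ∀ v, ∀ a ∈ S, ∀ b ∈ S, a ≠ v → b ≠ v →
      ∃ p : G.Walk a b, ∀ x ∈ p.support, x ∈ S ∧ x ≠ v) :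
    ((⊤ : G.Subgraph).induce S).Connected ∧
      ∀ v, ¬ ((⊤ : G.Subgraph).induce S).coe.IsCutVertex v := by
  set H := (⊤ : G.Subgraph).induce S with hH
  have hconn : H.Connected := by
    rw [Subgraph.connected_iff']
    have : Nonempty H.verts := hS.to_subtype
    refine Connected.mk ?_
    have key : ∀ {a b : V} (p : G.Walk a b) (h : ∀ x ∈ p.support, x ∈ S),
        H.coe.Reachable ⟨a, h a (by simp)⟩ ⟨b, h b (by simp)⟩ := by
      intro a b p
      induction p with
      | nil => intro h; exact Reachable.refl _
      | cons hadj p ih =>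
        intro h
        refine Reachable.trans (Adj.reachable ?_) (ih fun x hx => h x (by simp [hx]))
        simp only [Subgraph.coe_adj, hH, Subgraph.induce_adj, Subgraph.top_adj]
        exact ⟨h _ (by simp), h _ (by simp), hadj⟩
    rintro ⟨a, ha⟩ ⟨b, hb⟩
    obtain ⟨p, hp⟩ := hc a ha b hb
    exact key p hp
  refine ⟨hconn, fun v hv => ?_⟩
  have key : ∀ {a b : V} (p : G.Walk a b) (h : ∀ x ∈ p.support, x ∈ S ∧ x ≠ v),
      (H.coe.induce ({v}ᶜ : Set H.verts)).Reachable
        ⟨⟨a, (h a (by simp)).1⟩, fun e => (h a (by simp)).2 (congrArg Subtype.val e)⟩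
        ⟨⟨b, (h b (by simp)).1⟩, fun e => (h b (by simp)).2 (congrArg Subtype.val e)⟩ := by
    intro a b p
    induction p with
    | nil => intro h; exact Reachable.refl _
    | cons hadj p ih =>
      intro h
      refine Reachable.trans (Adj.reachable ?_) (ih fun x hx => h x (by simp [hx]))
      simp only [comap_adj, Function.Embedding.subtype_apply, Subgraph.coe_adj, hH,
        Subgraph.induce_adj, Subgraph.top_adj]
      exact ⟨(h _ (by simp)).1, (h _ (by simp)).1, hadj⟩
  have hsub : Subsingleton (H.coe.induce ({v}ᶜ : Set H.verts)).ConnectedComponent := by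
    refine Preconnected.subsingleton_connectedComponent ?_
    rintro ⟨⟨a, ha⟩, ha'⟩ ⟨⟨b, hb⟩, hb'⟩
    obtain ⟨p, hp⟩ := hs v a ha b hb (fun e => ha' (Subtype.ext e)) (fun e => hb' (Subtype.ext e))
    exact key p hp
  have h1 := Finite.card_le_one_iff_subsingleton.2 hsub
  have : Nonempty H.coe.ConnectedComponent := ⟨H.coe.connectedComponentMk v⟩
  have h2 : 0 < Nat.card H.coe.ConnectedComponent := Finite.card_pos
  unfold IsCutVertex at hv
  omega

theorem Adj.exists_isBlock [Finite V] {x y : V} (h : G.Adj x y) :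
    ∃ B : G.Subgraph, G.IsBlock B ∧ x ∈ B.verts ∧ y ∈ B.verts := by
  have hc : ∀ a ∈ ({x, y} : Set V), ∀ b ∈ ({x, y} : Set V),
      ∃ p : G.Walk a b, ∀ z ∈ p.support, z = a ∨ z = b := by
    rintro a (rfl | rfl) b (rfl | rfl)
    · exact ⟨Walk.nil, by simp⟩
    · exact ⟨Walk.cons h Walk.nil, by simp⟩
    · exact ⟨Walk.cons h.symm Walk.nil, by simp⟩
    · exact ⟨Walk.nil, by simp⟩
  have key := G.connected_and_not_isCutVertex_induce (S := {x, y}) ⟨x, by simp⟩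
    (fun a ha b hb => by
      obtain ⟨p, hp⟩ := hc a ha b hb
      refine ⟨p, fun z hz => ?_⟩
      rcases hp z hz with rfl | rfl <;> assumption)
    (fun v a ha b hb hav hbv => by
      obtain ⟨p, hp⟩ := hc a ha b hb
      refine ⟨p, fun z hz => ?_⟩
      rcases hp z hz with rfl | rfl
      · exact ⟨ha, hav⟩
      · exact ⟨hb, hbv⟩)
  obtain ⟨B, hle, hB⟩ := Finite.exists_le_maximal
    (p := fun H : G.Subgraph => H.Connected ∧ ∀ v, ¬ H.coe.IsCutVertex v) key
  exact ⟨B, hB, hle.1 (by simp), hle.1 (by simp)⟩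

/-- A path between two vertices of a clique block stays in the block. -/
theorem IsBlock.support_subset [Finite V] {B : G.Subgraph} (hB : G.IsBlock B)
    (hcl : G.IsClique B.verts) {a b : V} {p : G.Walk a b} (hp : p.IsPath) (ha : a ∈ B.verts)
    (hb : b ∈ B.verts) : ∀ x ∈ p.support, x ∈ B.verts := by
  by_cases hab : a = b
  · subst hab
    rw [hp.eq_nil_of_closed]
    simpa using ha
  -- Adding an ear to a clique block creates no cut vertex: when `v` is deleted, each remaining
  -- vertex of the ear still reaches the clique through one of the two ends. Maximality of `B` then
  -- absorbs the ear.
  set S : Set V := B.verts ∪ {x | x ∈ p.support} with hS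
  have hclS : ∀ c ∈ B.verts, ∀ d ∈ B.verts, ∃ q : G.Walk c d, ∀ x ∈ q.support, x = c ∨ x = d := by
    intro c hc d hd
    by_cases hcd : c = d
    · subst hcd
      exact ⟨Walk.nil, by simp⟩
    · exact ⟨Walk.cons (hcl hc hd hcd) Walk.nil, by simp⟩
  have hto : ∀ v, ∀ c ∈ S, c ≠ v → ∃ d ∈ B.verts, d ≠ v ∧
      ∃ q : G.Walk c d, ∀ x ∈ q.support, x ∈ S ∧ x ≠ v := by
    rintro v c (hc | hc) hcv
    · exact ⟨c, hc, hcv, Walk.nil, by simp [hS, hc, hcv]⟩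
    · obtain ⟨q, r, rfl⟩ := Walk.mem_support_iff_exists_append.1 hc
      by_cases hv : v ∈ q.support
      · have hvr : v ∉ r.support := fun h => hcv (hp.eq_of_append_of_mem hv h).symm
        refine ⟨b, hb, fun e => hvr (by simp [← e]), r, fun x hx => ⟨Or.inr ?_, ?_⟩⟩
        · simp [Walk.mem_support_append_iff, hx]
        · rintro rfl; exact hvr hx
      · refine ⟨a, ha, fun e => hv (by simp [← e]), q.reverse, fun x hx => ⟨Or.inr ?_, ?_⟩⟩
        · rw [Walk.support_reverse, List.mem_reverse] at hx
          simp [Walk.mem_support_append_iff, hx]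
        · rintro rfl; exact hv (by simpa using hx)
  have hs : ∀ v, ∀ c ∈ S, ∀ d ∈ S, c ≠ v → d ≠ v →
      ∃ q : G.Walk c d, ∀ x ∈ q.support, x ∈ S ∧ x ≠ v := by
    intro v c hc d hd hcv hdv
    obtain ⟨c', hc', hcv', q, hq⟩ := hto v c hc hcv
    obtain ⟨d', hd', hdv', r, hr⟩ := hto v d hd hdv
    obtain ⟨t, ht⟩ := hclS c' hc' d' hd'
    refine ⟨(q.append t).append r.reverse, fun x hx => ?_⟩
    simp only [Walk.mem_support_append_iff, Walk.support_reverse, List.mem_reverse] at hx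
    rcases hx with (hx | hx) | hx
    · exact hq x hx
    · rcases ht x hx with rfl | rfl
      · exact ⟨Or.inl hc', hcv'⟩
      · exact ⟨Or.inl hd', hdv'⟩
    · exact hr x hx
  have hc : ∀ c ∈ S, ∀ d ∈ S, ∃ q : G.Walk c d, ∀ x ∈ q.support, x ∈ S := by
    have haS : ∀ c ∈ S, ∃ q : G.Walk c a, ∀ x ∈ q.support, x ∈ S := by
      rintro c (hc | hc)
      · obtain ⟨t, ht⟩ := hclS c hc a ha
        refine ⟨t, fun x hx => Or.inl ?_⟩
        rcases ht x hx with rfl | rfl <;> assumption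
      · obtain ⟨q, r, rfl⟩ := Walk.mem_support_iff_exists_append.1 hc
        refine ⟨q.reverse, fun x hx => Or.inr ?_⟩
        rw [Walk.support_reverse, List.mem_reverse] at hx
        simp [Walk.mem_support_append_iff, hx]
    intro c hc d hd
    obtain ⟨q, hq⟩ := haS c hc
    obtain ⟨r, hr⟩ := haS d hd
    refine ⟨q.append r.reverse, fun x hx => ?_⟩
    simp only [Walk.mem_support_append_iff, Walk.support_reverse, List.mem_reverse] at hx
    exact hx.elim (hq x) (hr x)
  have hle : B ≤ (⊤ : G.Subgraph).induce S :=
    ⟨fun x hx => Or.inl hx, fun x y hxy =>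
      ⟨Or.inl (B.edge_vert hxy), Or.inl (B.edge_vert hxy.symm), B.adj_sub hxy⟩⟩
  have := hB.2 (connected_and_not_isCutVertex_induce ⟨a, Or.inl ha⟩ hc hs) hle
  exact fun x hx => this.1 (Or.inr hx)

/-- The long path is `p`, then a Hamiltonian path of the block from `a` to `b`, then `q`. If `p` and
`q` met, a path from `b` to `a` through a common vertex would put that vertex in `B`, making it
equal to both `a` and `b`. The length of `p` is discarded. -/
theorem IsBlock.length_add_card_le_detourDist [Finite V] {B : G.Subgraph} (hB : G.IsBlock B)
    (hcl : G.IsClique B.verts) {w a b y : V} {p : G.Walk w a} {q : G.Walk b y} (hp : p.IsPath)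
    (hq : q.IsPath) (ha : a ∈ B.verts) (hb : b ∈ B.verts) (hab : a ≠ b)
    (hpB : ∀ x ∈ p.support, x ∈ B.verts → x = a) (hqB : ∀ x ∈ q.support, x ∈ B.verts → x = b) :
    B.verts.ncard + q.length ≤ G.detourDist w y + 1 := by
  obtain ⟨r, hr, hrB, hrl⟩ := hcl.exists_isPath_length_eq_ncard ha hb hab
  have h1 : (p.append r).IsPath := hp.append_of_inter hr fun x hx hx' => hpB x hx (hrB x hx')
  have h2 : ((p.append r).append q).IsPath := by
    refine h1.append_of_inter hq fun x hx hxq => ?_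
    rcases (Walk.mem_support_append_iff _ _).1 hx with hx | hx
    · obtain ⟨t, htp, htq, s, hs, ht⟩ := hp.exists_isPath_through_common hq hx hxq
      have htB := hB.support_subset hcl hs hb ha t ht
      exact absurd ((hpB t htp htB).symm.trans (hqB t htq htB)) hab
    · exact hqB x hxq (hrB x hx)
  have := h2.length_le_detourDist
  simp only [Walk.length_append] at this
  omega

/-- In a block graph, the detour distance to a fixed vertex is quasi-convex along paths. -/
theorem IsBlockGraph.detourDist_le_max [Finite V] (hG : G.IsBlockGraph) {w₁ w₂ x : V}
    {p : G.Walk w₁ w₂} (hp : p.IsPath) (hx : x ∈ p.support) (y : V) :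
    G.detourDist x y ≤ max (G.detourDist w₁ y) (G.detourDist w₂ y) := by
  obtain ⟨p₁, p₂, rfl⟩ := Walk.mem_support_iff_exists_append.1 hx
  obtain ⟨q, hq, hql⟩ := hG.1.exists_isPath_length_eq_detourDist x y
  have avoid : ∀ {w : V} (r : G.Walk w x), r.IsPath →
      (∀ z ∈ r.support, z ∈ q.support → z = x) → G.detourDist x y ≤ G.detourDist w y := by
    intro w r hr h
    have := (hr.append_of_inter hq h).length_le_detourDist
    rw [Walk.length_append] at this
    omega
  -- If one half of the path meets the longest path `q` only at `x`, it can be prepended to `q`.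
  -- Otherwise both halves return to `q`.
  by_cases h1 : ∀ z ∈ p₁.support, z ∈ q.support → z = x
  · exact le_max_of_le_left (avoid p₁ hp.of_append_left h1)
  by_cases h2 : ∀ z ∈ p₂.reverse.support, z ∈ q.support → z = x
  · exact le_max_of_le_right (avoid _ hp.of_append_right.reverse h2)
  cases q with
  | nil => simp at h1
  | @cons _ c _ hadj q' =>
  rw [Walk.cons_isPath_iff] at hq
  obtain ⟨B, hB, hxB, hcB⟩ := hadj.exists_isBlock
  have hcl := hG.2 B hB
  -- A half that returns to `q` meets the block `B` of the first edge of `q` in a vertex other than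
  -- `x`, so its first vertex in `B` is not `x` either.
  have enter : ∀ {w : V} (r : G.Walk w x), r.IsPath →
      (¬ ∀ z ∈ r.support, z ∈ (Walk.cons hadj q').support → z = x) →
      ∃ a ∈ B.verts, a ≠ x ∧ a ∈ r.support ∧ ∃ s : G.Walk w a, s.IsPath ∧
        ∀ z ∈ s.support, z ∈ B.verts → z = a := by
    intro w r hr h
    push Not at h
    obtain ⟨z, hzr, hzq, hzx⟩ := h
    rw [Walk.support_cons, List.mem_cons] at hzq
    obtain ⟨t, htr, htq, s, hs, hts⟩ :=
      hr.exists_isPath_through_common hq.1 hzr (hzq.resolve_left hzx)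
    have htB := hB.support_subset hcl hs hcB hxB t hts
    have htx : t ≠ x := fun e => hq.2 (e ▸ htq)
    obtain ⟨a, ha, r₁, r₂, rfl, hfirst⟩ := r.exists_append_first hxB
    refine ⟨a, ha, ?_, by simp [Walk.mem_support_append_iff], r₁, hr.of_append_left, hfirst⟩
    rintro rfl
    rw [hr.of_append_right.eq_nil_of_closed, Walk.append_nil] at htr
    exact htx (hfirst t htr htB)
  obtain ⟨a₁, ha₁, ha₁x, ha₁p, s₁, hs₁, hf₁⟩ := enter p₁ hp.of_append_left h1
  obtain ⟨a₂, ha₂, ha₂x, ha₂p, s₂, hs₂, hf₂⟩ := enter p₂.reverse hp.of_append_right.reverse h2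
  have ha : a₁ ≠ a₂ := by
    rintro rfl
    exact ha₁x (hp.eq_of_append_of_mem ha₁p (by simpa using ha₂p))
  obtain ⟨b, hb, q₁, q₂, hqe, hlast⟩ := (Walk.cons hadj q').exists_append_last hxB
  have hq' : (q₁.append q₂).IsPath := by rw [← hqe, Walk.cons_isPath_iff]; exact hq
  have hl₁ := hq'.of_append_left.length_lt_card_of_support_subset B.verts.toFinite
    (hB.support_subset hcl hq'.of_append_left hxB hb)
  rw [hqe, Walk.length_append] at hql
  -- The entry points `a₁ ≠ a₂` cannot both equal the exit point `b` of `q`. Using one that differs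
  -- from `b`, a full tour of `B` replaces the part of `q` inside `B`, which is no longer than that
  -- tour.
  by_cases hb₁ : a₁ = b
  · have := hB.length_add_card_le_detourDist hcl hs₂ hq'.of_append_right ha₂ hb
      (fun e => ha (hb₁.trans e.symm)) hf₂ hlast
    exact le_max_of_le_right (by omega)
  · have := hB.length_add_card_le_detourDist hcl hs₁ hq'.of_append_right ha₁ hb hb₁ hf₁ hlast
    exact le_max_of_le_left (by omega)

theorem IsBlockGraph.exists_isBlock_card_le_detourDist [Finite V] (hG : G.IsBlockGraph)
    {w v : V} (hwv : w ≠ v) :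
    ∃ B : G.Subgraph, G.IsBlock B ∧ w ∈ B.verts ∧ B.verts.ncard ≤ G.detourDist w v + 1 := by
  obtain ⟨p, hp⟩ := hG.1.exists_isPath w v
  cases p with
  | nil => exact absurd rfl hwv
  | @cons _ c _ hadj p =>
  obtain ⟨B, hB, hwB, hcB⟩ := hadj.exists_isBlock
  refine ⟨B, hB, hwB, ?_⟩
  obtain ⟨b, hb, q, r, he, hlast⟩ := (Walk.cons hadj p).exists_append_last hwB
  have hqr : (q.append r).IsPath := he ▸ hp
  have hwb : w ≠ b := by
    rintro rfl
    rw [hqr.of_append_left.eq_nil_of_closed, Walk.nil_append] at he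
    exact hadj.ne (hlast c (by simp [← he]) hcB).symm
  have := hB.length_add_card_le_detourDist (hG.2 B hB) (p := (Walk.nil : G.Walk w w))
    Walk.IsPath.nil hqr.of_append_right hwB hb hwb (by simp) hlast
  omega

end Block

/-! ### The detour center and detour levels. -/

section Center

variable [Fintype V]

theorem detourCenter_nonempty [Nonempty V] : G.detourCenter.Nonempty := by
  obtain ⟨v, -, hv⟩ := Finset.exists_min_image Finset.univ G.detourEcc Finset.univ_nonempty
  exact ⟨v, fun u => hv u (Finset.mem_univ u)⟩

/-- By quasi-convexity the eccentricity of `x` is at most the larger of those of `w₁` and `w₂`,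
which are minimal. -/
theorem IsBlockGraph.mem_detourCenter_of_mem_support (hG : G.IsBlockGraph) {w₁ w₂ x : V}
    (h₁ : w₁ ∈ G.detourCenter) (h₂ : w₂ ∈ G.detourCenter) {p : G.Walk w₁ w₂} (hp : p.IsPath)
    (hx : x ∈ p.support) : x ∈ G.detourCenter := by
  intro u
  refine Finset.sup_le fun y _ => (hG.detourDist_le_max hp hx y).trans (max_le ?_ ?_)
  · exact (Finset.le_sup (f := fun u => G.detourDist w₁ u) (Finset.mem_univ y)).trans (h₁ u)
  · exact (Finset.le_sup (f := fun u => G.detourDist w₂ u) (Finset.mem_univ y)).trans (h₂ u)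

theorem IsBlockGraph.detourDist_lt_detourOmega (hG : G.IsBlockGraph) {w₁ w₂ : V}
    (h₁ : w₁ ∈ G.detourCenter) (h₂ : w₂ ∈ G.detourCenter) :
    G.detourDist w₁ w₂ < G.detourOmega := by
  obtain ⟨p, hp, hl⟩ := hG.1.exists_isPath_length_eq_detourDist w₁ w₂
  rw [← hl]
  exact hp.length_lt_card_of_support_subset (Set.toFinite _)
    fun x hx => hG.mem_detourCenter_of_mem_support h₁ h₂ hp hx

theorem exists_detourDist_eq_detourLevel [Nonempty V] (u : V) :
    ∃ w ∈ G.detourCenter, G.detourDist w u = G.detourLevel u :=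
  Nat.sInf_mem (G.detourCenter_nonempty.image fun w => G.detourDist w u)

theorem IsBlockGraph.detourDist_lt_detourLevel_add (hG : G.IsBlockGraph) (u v : V) :
    G.detourDist u v < G.detourLevel u + G.detourLevel v + G.detourOmega := by
  have := hG.1.nonempty
  obtain ⟨w₁, h₁, e₁⟩ := G.exists_detourDist_eq_detourLevel u
  obtain ⟨w₂, h₂, e₂⟩ := G.exists_detourDist_eq_detourLevel v
  have t₁ := hG.1.detourDist_triangle u w₁ v
  have t₂ := hG.1.detourDist_triangle w₁ w₂ v
  have t₃ := hG.detourDist_lt_detourOmega h₁ h₂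
  rw [G.detourDist_comm u w₁] at t₁
  omega

/-- A path from the center to `v` starts inside some block, and that block can be toured completely
before leaving it. -/
theorem IsBlockGraph.detourXi_le_detourLevel (hG : G.IsBlockGraph) (hω : G.detourOmega = 1)
    {v : V} (hv : v ∉ G.detourCenter) : G.detourXi ≤ G.detourLevel v := by
  have := hG.1.nonempty
  obtain ⟨w, hw, e⟩ := G.exists_detourDist_eq_detourLevel v
  obtain ⟨B, hB, hwB, hle⟩ := hG.exists_isBlock_card_le_detourDist (w := w) (v := v)
    (fun h => hv (h ▸ hw))
  rw [detourXi, if_pos hω]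
  have hmem : B.verts.ncard - 1 ∈ {k : ℕ | ∃ B : G.Subgraph, G.IsBlock B ∧
      (∃ w ∈ G.detourCenter, w ∈ B.verts) ∧ k = B.verts.ncard - 1} :=
    ⟨B, hB, ⟨w, hw, hwB⟩, rfl⟩
  exact (Nat.sInf_le hmem).trans (by omega)

theorem detourXi_eq_zero_of_subsingleton [Subsingleton V] : G.detourXi = 0 := by
  rw [detourXi]
  split_ifs with hω
  · refine Nat.eq_zero_of_le_zero ?_
    by_contra h
    obtain ⟨B, -, -, h'⟩ := Nat.sInf_mem (Nat.nonempty_of_pos_sInf (not_le.1 h))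
    have := Set.ncard_le_one_of_subsingleton B.verts
    omega
  · rfl

theorem Connected.detourLevel_eq_zero (hG : G.Connected) {v : V} (hv : v ∈ G.detourCenter) :
    G.detourLevel v = 0 :=
  Nat.le_zero.1 (Nat.sInf_le ⟨v, hv, hG.detourDist_self v⟩)

end Center

end SimpleGraph

namespace SimpleGraph

/-! ### Vertex orderings and the lower bound for the largest color. -/

section Coloring

variable {V : Type*} [Fintype V] {G : SimpleGraph V}

theorem exists_isVertexOrdering_monotoneOn [Nonempty V] (c : V → ℕ) :
    ∃ u : ℕ → V, IsVertexOrdering u ∧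
      ∀ i j, i ≤ j → j < Fintype.card V → c (u i) ≤ c (u j) := by
  classical
  let e := Fintype.equivFin V
  let σ := Tuple.sort (c ∘ e.symm)
  let u : ℕ → V := fun i =>
    if h : i < Fintype.card V then e.symm (σ ⟨i, h⟩) else Classical.arbitrary V
  have hu : ∀ i (h : i < Fintype.card V), u i = e.symm (σ ⟨i, h⟩) := fun i h => dif_pos h
  refine ⟨u, ⟨fun _ _ => trivial, fun i hi j hj hij => ?_, fun v _ => ?_⟩, fun i j hij hj => ?_⟩
  · rw [hu i hi, hu j hj] at hij
    exact Fin.mk.inj (σ.injective (e.symm.injective hij))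
  · exact ⟨σ.symm (e v), Fin.is_lt _, by rw [hu _ (Fin.is_lt _)]; simp⟩
  · rw [hu i (hij.trans_lt hj), hu j hj]
    exact Tuple.monotone_sort (c ∘ e.symm) (Fin.mk_le_mk.2 hij)

theorem IsVertexOrdering.reverse {u : ℕ → V} (hu : IsVertexOrdering u) :
    IsVertexOrdering fun i => u (Fintype.card V - 1 - i) := by
  refine ⟨fun _ _ => trivial, fun i hi j hj hij => ?_, fun v hv => ?_⟩
  · simp only [Set.mem_Iio] at hi hj
    have h := hu.2.1 (show Fintype.card V - 1 - i < Fintype.card V by omega)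
      (show Fintype.card V - 1 - j < Fintype.card V by omega) hij
    omega
  · obtain ⟨i, hi, rfl⟩ := hu.2.2 hv
    simp only [Set.mem_Iio] at hi
    refine ⟨Fintype.card V - 1 - i, by simp only [Set.mem_Iio]; omega, ?_⟩
    dsimp only
    congr 1
    omega

theorem IsVertexOrdering.ne {u : ℕ → V} (hu : IsVertexOrdering u) {i j : ℕ}
    (hi : i < Fintype.card V) (hj : j < Fintype.card V) (hij : i ≠ j) : u i ≠ u j :=
  fun h => hij (hu.2.1 hi hj h)

theorem IsVertexOrdering.exists_eq {u : ℕ → V} (hu : IsVertexOrdering u) (v : V) :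
    ∃ i < Fintype.card V, u i = v :=
  hu.2.2 (Set.mem_univ v)

theorem IsVertexOrdering.sum_detourLevel [Nonempty V] {u : ℕ → V} (hu : IsVertexOrdering u) :
    ∑ t ∈ Finset.range (Fintype.card V - 1),
        ((G.detourLevel (u t) : ℤ) + (G.detourLevel (u (t + 1)) : ℤ)) =
      2 * (G.totalDetourLevel : ℤ) - G.detourLevel (u 0)
        - G.detourLevel (u (Fintype.card V - 1)) := by
  have htot : ∑ t ∈ Finset.range (Fintype.card V), (G.detourLevel (u t) : ℤ) =
      G.totalDetourLevel := by
    rw [totalDetourLevel, Nat.cast_sum]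
    refine Finset.sum_bij (fun t _ => u t) (fun _ _ => Finset.mem_univ _)
      (fun i hi j hj h => hu.2.1 (by simpa using hi) (by simpa using hj) h)
      (fun v _ => ?_) (fun _ _ => rfl)
    obtain ⟨i, hi, h⟩ := hu.exists_eq v
    exact ⟨i, by simpa using hi, h⟩
  obtain ⟨m, hm⟩ : ∃ m, Fintype.card V = m + 1 :=
    ⟨Fintype.card V - 1, (Nat.sub_add_cancel Fintype.card_pos).symm⟩
  rw [hm] at htot ⊢
  rw [Nat.add_sub_cancel, Finset.sum_add_distrib]
  have h1 := htot
  rw [Finset.sum_range_succ] at h1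
  rw [Finset.sum_range_succ'] at htot
  linarith

/-- When `ω = 1` and there are at least two vertices, the ends of the ordering are distinct, so one
of them is not central. For a single vertex the ends coincide, but `ξ = 0`. -/
theorem IsBlockGraph.detourXi_le_of_isVertexOrdering (hG : G.IsBlockGraph) {u : ℕ → V}
    (hu : IsVertexOrdering u) :
    G.detourXi ≤ G.detourLevel (u 0) + G.detourLevel (u (Fintype.card V - 1)) := by
  by_cases hω : G.detourOmega = 1
  · rcases subsingleton_or_nontrivial V with h | h
    · simp [detourXi_eq_zero_of_subsingleton]
    · have hcard := Fintype.one_lt_card (α := V)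
      have hne := hu.ne (i := 0) (j := Fintype.card V - 1) (by omega) (by omega) (by omega)
      by_cases h0 : u 0 ∈ G.detourCenter
      · refine (hG.detourXi_le_detourLevel hω fun h1 => hne ?_).trans (Nat.le_add_left _ _)
        obtain ⟨w, hw⟩ := Set.ncard_eq_one.1 hω
        rw [hw] at h0 h1
        exact (h0 : u 0 = w).trans (h1 : _ = w).symm
      · exact (hG.detourXi_le_detourLevel hω h0).trans (Nat.le_add_right _ _)
  · simp [detourXi, hω]

theorem IsHamiltonianColoring.reverse {c : V → ℕ} (hc : G.IsHamiltonianColoring c) {m : ℕ}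
    (hm : ∀ v, c v ≤ m) : G.IsHamiltonianColoring fun v => m - c v := by
  intro u v huv
  have h : ((m - c u : ℕ) : ℤ) - ((m - c v : ℕ) : ℤ) = (c v : ℤ) - c u := by
    have := hm u
    have := hm v
    omega
  rw [h, abs_sub_comm]
  exact hc u v huv

theorem exists_isHamiltonianColoring :
    ∃ c : V → ℕ, G.IsHamiltonianColoring c := by
  -- Distinct multiples of `n` differ by at least `n`, whatever the detour distances.
  refine ⟨fun v => Fintype.card V * (Fintype.equivFin V v : ℕ), fun u v huv => ?_⟩
  have hne : ((Fintype.equivFin V u : ℕ) : ℤ) - ((Fintype.equivFin V v : ℕ) : ℤ) ≠ 0 := by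
    intro h
    refine huv ((Fintype.equivFin V).injective (Fin.ext ?_))
    omega
  have h1 := Int.one_le_abs hne
  push_cast
  rw [← mul_sub, abs_mul, Nat.abs_cast]
  nlinarith [Nat.cast_nonneg (α := ℤ) (Fintype.card V),
    Nat.cast_nonneg (α := ℤ) (G.detourDist u v)]

theorem exists_isOptimalHamiltonianColoring : ∃ c : V → ℕ, G.IsOptimalHamiltonianColoring c := by
  obtain ⟨c, hc⟩ := G.exists_isHamiltonianColoring
  obtain ⟨d, hd, h⟩ := Nat.sInf_mem
    (s := {k : ℕ | ∃ c : V → ℕ, G.IsHamiltonianColoring c ∧ k = Finset.univ.sup c}) ⟨_, c, hc, rfl⟩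
  exact ⟨d, hd, h.symm⟩

/-- The increase of the colors from one vertex of an ordering to the next is at least
`n - ω - 𝓛(u i) - 𝓛(u (i + 1))`. -/
theorem IsBlockGraph.sub_detourLevel_le (hG : G.IsBlockGraph) {c : V → ℕ}
    (hc : G.IsHamiltonianColoring c) {u : ℕ → V} (hu : IsVertexOrdering u)
    (hmono : ∀ i j, i ≤ j → j < Fintype.card V → c (u i) ≤ c (u j)) {i : ℕ}
    (hi : i + 1 < Fintype.card V) :
    (Fintype.card V : ℤ) - G.detourOmega - G.detourLevel (u i) - G.detourLevel (u (i + 1)) ≤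
      (c (u (i + 1)) : ℤ) - c (u i) := by
  have h1 := hc _ _ (hu.ne (i := i + 1) (j := i) hi (by omega) (by omega))
  have h2 := hG.detourDist_lt_detourLevel_add (u (i + 1)) (u i)
  have h3 := hmono i (i + 1) (by omega) hi
  rw [abs_of_nonneg (by omega)] at h1
  omega

theorem IsVertexOrdering.sum_sub_detourLevel [Nonempty V] {u : ℕ → V} (hu : IsVertexOrdering u) :
    ∑ t ∈ Finset.range (Fintype.card V - 1), ((Fintype.card V : ℤ) - G.detourOmega
        - G.detourLevel (u t) - G.detourLevel (u (t + 1))) =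
      ((Fintype.card V : ℤ) - 1) * ((Fintype.card V : ℤ) - G.detourOmega)
        - 2 * G.totalDetourLevel + G.detourLevel (u 0)
        + G.detourLevel (u (Fintype.card V - 1)) := by
  have h := hu.sum_detourLevel (G := G)
  have hcard : ((Fintype.card V - 1 : ℕ) : ℤ) = (Fintype.card V : ℤ) - 1 := by
    have := Fintype.card_pos (α := V)
    omega
  simp only [sub_sub ((Fintype.card V : ℤ) - G.detourOmega)]
  rw [Finset.sum_sub_distrib, h, Finset.sum_const, Finset.card_range, nsmul_eq_mul, hcard]
  ring

/-- The lower bound for the largest color of a hamiltonian coloring of a block graph. -/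
theorem IsBlockGraph.le_sup_of_isHamiltonianColoring (hG : G.IsBlockGraph) {c : V → ℕ}
    (hc : G.IsHamiltonianColoring c) :
    ((Fintype.card V : ℤ) - 1) * ((Fintype.card V : ℤ) - (G.detourOmega : ℤ))
      - 2 * (G.totalDetourLevel : ℤ) + (G.detourXi : ℤ) ≤ (Finset.univ.sup c : ℕ) := by
  have := hG.1.nonempty
  obtain ⟨u, hu, hmono⟩ := exists_isVertexOrdering_monotoneOn c
  have h1 := Finset.sum_le_sum fun t (ht : t ∈ Finset.range (Fintype.card V - 1)) =>
    hG.sub_detourLevel_le hc hu hmono (i := t) (by rw [Finset.mem_range] at ht; omega)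
  rw [IsVertexOrdering.sum_sub_detourLevel hu, Finset.sum_range_sub (fun i => (c (u i) : ℤ))] at h1
  have h2 := hG.detourXi_le_of_isVertexOrdering hu
  have h3 : c (u (Fintype.card V - 1)) ≤ Finset.univ.sup c := Finset.le_sup (Finset.mem_univ _)
  zify at h2 h3
  linarith [Nat.cast_nonneg (α := ℤ) (c (u 0))]

theorem IsBlockGraph.le_hamChromaticNumber (hG : G.IsBlockGraph) :
    ((Fintype.card V : ℤ) - 1) * ((Fintype.card V : ℤ) - (G.detourOmega : ℤ))
      - 2 * (G.totalDetourLevel : ℤ) + (G.detourXi : ℤ) ≤ G.hamChromaticNumber := by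
  obtain ⟨c, hc, h⟩ := G.exists_isOptimalHamiltonianColoring
  exact h ▸ hG.le_sup_of_isHamiltonianColoring hc

/-! ### Equality in the lower bound. -/

theorem sub_eq_of_steps {f : ℕ → ℤ} {g : ℕ → ℤ} {k : ℤ} {n : ℕ}
    (h : ∀ i, i + 1 < n → f (i + 1) - f i = k - g i) {i j : ℕ} (hij : i ≤ j) (hj : j < n) :
    f j - f i = ((j : ℤ) - i) * k - ∑ t ∈ Finset.Ico i j, g t := by
  induction j, hij using Nat.le_induction with
  | base => simp
  | succ j hij ih =>
    rw [Finset.sum_Ico_succ_top hij]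
    have h1 := ih (by omega)
    have h2 := h j hj
    push_cast
    linarith

/-- A hamiltonian coloring attaining the lower bound satisfies all inequalities of a tight
ordering along any ordering by increasing colors. -/
theorem IsBlockGraph.of_sup_le (hG : G.IsBlockGraph) {c : V → ℕ}
    (hc : G.IsHamiltonianColoring c)
    (hle : ((Finset.univ.sup c : ℕ) : ℤ) ≤
      ((Fintype.card V : ℤ) - 1) * ((Fintype.card V : ℤ) - (G.detourOmega : ℤ))
        - 2 * (G.totalDetourLevel : ℤ) + (G.detourXi : ℤ))
    {u : ℕ → V} (hu : IsVertexOrdering u)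
    (hmono : ∀ i j, i ≤ j → j < Fintype.card V → c (u i) ≤ c (u j)) :
    G.detourLevel (u 0) + G.detourLevel (u (Fintype.card V - 1)) = G.detourXi ∧
    ∀ i j : ℕ, i < j → j < Fintype.card V →
      ∑ t ∈ Finset.Ico i j, ((G.detourLevel (u t) : ℤ) + (G.detourLevel (u (t + 1)) : ℤ))
          - ((j : ℤ) - (i : ℤ)) * ((Fintype.card V : ℤ) - (G.detourOmega : ℤ))
          + ((Fintype.card V : ℤ) - 1)
        ≤ (G.detourDist (u i) (u j) : ℤ) := by
  have := hG.1.nonempty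
  have hstep := fun t (ht : t ∈ Finset.range (Fintype.card V - 1)) =>
    hG.sub_detourLevel_le hc hu hmono (i := t) (by rw [Finset.mem_range] at ht; omega)
  have hs1 := IsVertexOrdering.sum_sub_detourLevel (G := G) hu
  have hs2 := Finset.sum_range_sub (fun i => (c (u i) : ℤ)) (Fintype.card V - 1)
  have h1 := Finset.sum_le_sum hstep
  have h2 := hG.detourXi_le_of_isVertexOrdering hu
  have h3 : c (u (Fintype.card V - 1)) ≤ Finset.univ.sup c := Finset.le_sup (Finset.mem_univ _)
  have h4 := Nat.cast_nonneg (α := ℤ) (c (u 0))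
  zify at h2 h3
  -- The termwise lower bounds have the same sum as the actual increments, so every step is tight.
  have heq := (Finset.sum_eq_sum_iff_of_le hstep).1 (by linarith)
  refine ⟨by zify; linarith, fun i j hij hj => ?_⟩
  have h5 := sub_eq_of_steps (f := fun i => (c (u i) : ℤ))
    (g := fun t => (G.detourLevel (u t) : ℤ) + (G.detourLevel (u (t + 1)) : ℤ))
    (k := (Fintype.card V : ℤ) - G.detourOmega) (n := Fintype.card V)
    (fun t ht => by
      have := heq t (by rw [Finset.mem_range]; omega)
      linarith) hij.le hj
  have h6 := hc _ _ (hu.ne (i := i) (j := j) (by omega) hj (by omega))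
  have h7 := hmono i j hij.le hj
  rw [abs_sub_comm, abs_of_nonneg (by omega)] at h6
  linarith

theorem IsBlockGraph.exists_isTightOrdering (hG : G.IsBlockGraph)
    (h : (G.hamChromaticNumber : ℤ) =
      ((Fintype.card V : ℤ) - 1) * ((Fintype.card V : ℤ) - (G.detourOmega : ℤ))
        - 2 * (G.totalDetourLevel : ℤ) + (G.detourXi : ℤ)) :
    ∃ u : ℕ → V, G.IsTightOrdering u := by
  have := hG.1.nonempty
  obtain ⟨c, hc, hcs⟩ := G.exists_isOptimalHamiltonianColoring
  rw [← hcs] at h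
  have key : ∀ u : ℕ → V, IsVertexOrdering u → ∀ d : V → ℕ, G.IsHamiltonianColoring d →
      Finset.univ.sup d ≤ Finset.univ.sup c →
      (∀ i j, i ≤ j → j < Fintype.card V → d (u i) ≤ d (u j)) →
      G.detourLevel (u 0) = 0 → G.IsTightOrdering u := by
    intro u hu d hd hds hmono h0
    obtain ⟨h1, h2⟩ := hG.of_sup_le hd (le_trans (by exact_mod_cast hds) h.le) hu hmono
    refine ⟨hu, h0, fun _ => by omega, fun hω => ?_, h2⟩
    have : G.detourXi = 0 := if_neg (by omega)
    omega
  obtain ⟨u, hu, hmono⟩ := exists_isVertexOrdering_monotoneOn c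
  by_cases h0 : G.detourLevel (u 0) = 0
  · exact ⟨u, key u hu c hc le_rfl hmono h0⟩
  -- The end levels add up to `ξ`, so a nonzero first level forces `ω = 1`, hence first level `ξ`
  -- and last level `0`. Reversing both the ordering and the colors puts the level `0` first.
  · have hsum := (hG.of_sup_le hc h.le hu hmono).1
    have hω : G.detourOmega = 1 := by
      by_contra hω
      have : G.detourXi = 0 := if_neg hω
      omega
    have hξ := hG.detourXi_le_detourLevel hω fun h => h0 (hG.1.detourLevel_eq_zero h)
    have hle : ∀ v, c v ≤ Finset.univ.sup c := fun v => Finset.le_sup (Finset.mem_univ v)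
    refine ⟨_, key _ hu.reverse _ (hc.reverse hle) (Finset.sup_le fun v _ => Nat.sub_le _ _)
      (fun i j hij hj => Nat.sub_le_sub_left (hmono _ _ (by omega) (by omega)) _) ?_⟩
    rw [Nat.sub_zero]
    omega

/-! ### The coloring defined by a tight ordering. -/

theorem IsBlockGraph.detourXi_eq_of_isTightOrdering (hG : G.IsBlockGraph) {u : ℕ → V}
    (hu : G.IsTightOrdering u) : G.detourLevel (u (Fintype.card V - 1)) = G.detourXi := by
  have := hG.1.nonempty
  have hpos : 0 < G.detourOmega := (Set.ncard_pos (Set.toFinite _)).2 G.detourCenter_nonempty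
  by_cases hω : G.detourOmega = 1
  · exact hu.2.2.1 hω
  · rw [hu.2.2.2.1 (by omega)]
    exact (if_neg hω).symm

/-- This is the required inequality for neighbors `i`, `i + 1` combined with `D ≤ n - 1`. It keeps
the recursively defined colors non-negative and increasing in the weak sense. -/
theorem IsTightOrdering.step_nonneg (hG : G.Connected) {u : ℕ → V} (hu : G.IsTightOrdering u)
    {i : ℕ} (hi : i + 1 < Fintype.card V) :
    0 ≤ (Fintype.card V : ℤ) - G.detourOmega - (G.detourLevel (u i) + G.detourLevel (u (i + 1))) := by
  have h1 := hu.2.2.2.2 i (i + 1) (by omega) hi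
  have h2 := hG.detourDist_lt_card (u i) (u (i + 1))
  rw [Nat.Ico_succ_singleton, Finset.sum_singleton] at h1
  push_cast at h1
  rw [add_sub_cancel_left, one_mul] at h1
  omega

theorem IsTightOrdering.existsUnique_isColoringAlong (hG : G.Connected) {u : ℕ → V}
    (hu : G.IsTightOrdering u) : ∃! c : V → ℕ, G.IsColoringAlong u c := by
  have := hG.nonempty
  choose idx hidx hidx' using hu.1.exists_eq
  have hinv : ∀ i < Fintype.card V, idx (u i) = i := fun i hi =>
    hu.1.2.1 (hidx _) hi (hidx' _)
  let f : ℕ → ℤ := fun i => ∑ t ∈ Finset.range i, ((Fintype.card V : ℤ) - G.detourOmega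
    - (G.detourLevel (u t) + G.detourLevel (u (t + 1))))
  have hf : ∀ i < Fintype.card V, 0 ≤ f i := fun i hi => Finset.sum_nonneg fun t ht =>
    hu.step_nonneg hG (by rw [Finset.mem_range] at ht; omega)
  -- The truncation `toNat` loses nothing, since the partial sums `f` are non-negative at all
  -- indices below `n`.
  refine ⟨fun v => (f (idx v)).toNat, ⟨?_, fun i hi => ?_⟩, fun d hd => ?_⟩
  · simp [hinv 0 Fintype.card_pos, f]
  · dsimp only
    rw [hinv _ hi, hinv _ (by omega), Int.toNat_of_nonneg (hf _ hi),
      Int.toNat_of_nonneg (hf i (by omega))]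
    simp only [f, Finset.sum_range_succ]
    ring
  · have key : ∀ i < Fintype.card V, (d (u i) : ℤ) = f i := by
      intro i
      induction i with
      | zero => intro _; simp [hd.1, f]
      | succ i ih =>
        intro hi
        rw [hd.2 i hi, ih (by omega)]
        simp only [f, Finset.sum_range_succ]
        ring
    funext v
    have := key (idx v) (hidx v)
    rw [hidx'] at this
    omega

theorem IsTightOrdering.isHamiltonianColoring_and_sup_eq (hG : G.IsBlockGraph) {u : ℕ → V}
    (hu : G.IsTightOrdering u) {c : V → ℕ} (hc : G.IsColoringAlong u c) :
    G.IsHamiltonianColoring c ∧ ((Finset.univ.sup c : ℕ) : ℤ) =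
      ((Fintype.card V : ℤ) - 1) * ((Fintype.card V : ℤ) - (G.detourOmega : ℤ))
        - 2 * (G.totalDetourLevel : ℤ) + (G.detourXi : ℤ) := by
  have := hG.1.nonempty
  have hdiff : ∀ {i j : ℕ}, i ≤ j → j < Fintype.card V → _ := fun {i j} hij hj =>
    sub_eq_of_steps (f := fun i => (c (u i) : ℤ))
      (g := fun t => (G.detourLevel (u t) : ℤ) + (G.detourLevel (u (t + 1)) : ℤ))
      (k := (Fintype.card V : ℤ) - G.detourOmega) (n := Fintype.card V)
      (fun t ht => by rw [hc.2 t ht]; ring) (i := i) (j := j) hij hj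
  have hmono : ∀ i j, i ≤ j → j < Fintype.card V → c (u i) ≤ c (u j) := by
    intro i j hij
    induction j, hij using Nat.le_induction with
    | base => exact fun _ => le_rfl
    | succ j hij ih =>
      intro hj
      have h1 := ih (by omega)
      have h2 := hc.2 j hj
      have h3 := hu.step_nonneg hG.1 hj
      omega
  have hlt : ∀ i j, i < j → j < Fintype.card V →
      (Fintype.card V : ℤ) - 1 ≤ G.detourDist (u i) (u j) + |(c (u i) : ℤ) - c (u j)| := by
    intro i j hij hj
    -- By telescoping, the color difference is `(j - i)(n - ω)` minus the sum of levels, which turns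
    -- this inequality into the coloring condition.
    have h1 := hu.2.2.2.2 i j hij hj
    have h2 := hdiff hij.le hj
    have h3 := hmono i j hij.le hj
    rw [abs_sub_comm, abs_of_nonneg (by omega)]
    linarith
  constructor
  · intro v w hvw
    obtain ⟨i, hi, rfl⟩ := hu.1.exists_eq v
    obtain ⟨j, hj, rfl⟩ := hu.1.exists_eq w
    rcases lt_trichotomy i j with h | rfl | h
    · exact hlt i j h hj
    · exact absurd rfl hvw
    · rw [detourDist_comm, abs_sub_comm]
      exact hlt j i h hi
  · have hsup : Finset.univ.sup c = c (u (Fintype.card V - 1)) := by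
      refine le_antisymm (Finset.sup_le fun v _ => ?_) (Finset.le_sup (Finset.mem_univ _))
      obtain ⟨i, hi, rfl⟩ := hu.1.exists_eq v
      exact hmono _ _ (by omega) (by omega)
    have hcard := Fintype.card_pos (α := V)
    have h1 := hdiff (Nat.zero_le (Fintype.card V - 1)) (by omega)
    rw [Nat.Ico_zero_eq_range, hu.1.sum_detourLevel, hu.2.1,
      hG.detourXi_eq_of_isTightOrdering hu, hc.1, Nat.cast_sub hcard] at h1
    rw [hsup]
    push_cast at h1
    linarith

theorem IsBlockGraph.hamChromaticNumber_eq_of_isTightOrdering (hG : G.IsBlockGraph) {u : ℕ → V}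
    (hu : G.IsTightOrdering u) :
    (G.hamChromaticNumber : ℤ) =
      ((Fintype.card V : ℤ) - 1) * ((Fintype.card V : ℤ) - (G.detourOmega : ℤ))
        - 2 * (G.totalDetourLevel : ℤ) + (G.detourXi : ℤ) := by
  obtain ⟨c, hc, -⟩ := hu.existsUnique_isColoringAlong hG.1
  obtain ⟨h1, h2⟩ := hu.isHamiltonianColoring_and_sup_eq hG hc
  refine le_antisymm ?_ hG.le_hamChromaticNumber
  have hmem : Finset.univ.sup c ∈
      {k : ℕ | ∃ c : V → ℕ, G.IsHamiltonianColoring c ∧ k = Finset.univ.sup c} := ⟨c, h1, rfl⟩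
  rw [← h2]
  exact_mod_cast Nat.sInf_le hmem

end Coloring

end SimpleGraph

theorem theorem2 {V : Type*} [Fintype V] (G : SimpleGraph V) (hG : G.IsBlockGraph) :
    ((G.hamChromaticNumber : ℤ) =
        ((Fintype.card V : ℤ) - 1) * ((Fintype.card V : ℤ) - (G.detourOmega : ℤ))
          - 2 * (G.totalDetourLevel : ℤ) + (G.detourXi : ℤ)
      ↔ ∃ u : ℕ → V, G.IsTightOrdering u) ∧
    ∀ u : ℕ → V, G.IsTightOrdering u →
      (∃! c : V → ℕ, G.IsColoringAlong u c) ∧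
      ∀ c : V → ℕ, G.IsColoringAlong u c → G.IsOptimalHamiltonianColoring c := by
  refine ⟨⟨hG.exists_isTightOrdering, fun ⟨u, hu⟩ =>
    hG.hamChromaticNumber_eq_of_isTightOrdering hu⟩, fun u hu =>
    ⟨hu.existsUnique_isColoringAlong hG.1, fun c hc => ?_⟩⟩
  obtain ⟨h1, h2⟩ := hu.isHamiltonianColoring_and_sup_eq hG hc
  refine ⟨h1, ?_⟩
  have := hG.hamChromaticNumber_eq_of_isTightOrdering hu
  omega
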